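/- **Theorem (strong basis forced vertices, even girth).** Let $G$ be a finite simple unicyclic graph (connected, with exactly one cycle) whose cycle $C=v_0v_1\cdots v_{g-1}v_0$ has even length $g$; indices are taken modulo $g$. For distinct vertices $x,y$, a vertex $w$ strongly resolves them if $d(w,x)=d(w,y)+d(y,x)$ or $d(w,y)=d(w,x)+d(x,y)$. A strong metric basis of $G$ is a set of vertices of smallest possible cardinality such that every two distinct vertices of $G$ are strongly resolved by some vertex of the set. A strong basis forced vertex is a vertex that belongs to every strong metric basis of $G$. Let $T_{v_i}$ be the component of $G-E(C)$ containing $v_i$, and let $Q_{v_i}$ be the set of vertices of $T_{v_{i+g/2}}$ that have degree one in $G$. Let $D_2$ (respectively $D_{>2}$) be the set of cycle vertices $v_i$ such that $v_i$ and $v_{i+g/2}$ both have degree two (respectively, both have degree larger than two) in $G$. (i) If $D_{>2}=\emptyset$, then $G$ has no strong basis forced vertices. (ii) If $D_{>2}\neq\emptyset$, then the set of strong basis forced vertices of $G$ is exactly $\bigcup_{v_i\notin D_2\cup D_{>2}}Q_{v_i}$, and its cardinality is $\sum_{v_i\notin D_2\cup D_{>2}}|Q_{v_i}|$, where $v_i$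 ranges over the vertices of $C$. (iii) If every vertex outside $C$ has degree one, then $Q_{v_i}$ is simply the set of vertices of degree one adjacent to $v_{i+g/2}$, for every $i$. -/

import Mathlib

namespace SimpleGraph

section StrongMetric

variable {V : Type*} (G : SimpleGraph V)

/-- The vertex `w` strongly resolves `x` and `y`: some shortest `w`-`x` path contains `y`, or some
shortest `w`-`y` path contains `x`. -/
def StronglyResolves (w x y : V) : Prop :=
  G.dist w x = G.dist w y + G.dist y x ∨ G.dist w y = G.dist w x + G.dist x y

/-- Every two different vertices are strongly resolved by some vertex of `S`. -/
def IsStrongResolvingSet (S : Finset V) : Prop :=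
  ∀ x y : V, x ≠ y → ∃ w ∈ S, G.StronglyResolves w x y

/-- A strong resolving set of smallest possible cardinality. -/
def IsStrongMetricBasis (S : Finset V) : Prop :=
  G.IsStrongResolvingSet S ∧ ∀ T : Finset V, G.IsStrongResolvingSet T → S.card ≤ T.card

/-- The set of strong basis forced vertices: those in every strong metric basis. -/
def strongBasisForced : Set V :=
  {x | ∀ S : Finset V, G.IsStrongMetricBasis S → x ∈ S}

end StrongMetric

section Unicyclic

variable {V : Type*} (G : SimpleGraph V)

/-- A connected graph with exactly one cycle, a cycle being regarded as a subgraph. -/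
def IsUnicyclic : Prop :=
  G.Connected ∧ ∃! C : G.Subgraph, ∃ (u : V) (p : G.Walk u u), p.IsCycle ∧ p.toSubgraph = C

/-- `v 0, v 1, …, v (g - 1), v 0` is a cycle of `G` of length `g`, with indices modulo `g`.
When `G` is unicyclic this is a labelling of its unique cycle, and `g` is the girth. -/
structure IsCycleLabelling {g : ℕ} (v : ZMod g → V) : Prop where
  three_le : 3 ≤ g
  injective : Function.Injective v
  adj : ∀ i, G.Adj (v i) (v (i + 1))

/-- The index of the vertex of the cycle antipodal to the vertex with index `i`. -/
def antipode {g : ℕ} (i : ZMod g) : ZMod g := i + ((g / 2 : ℕ) : ZMod g)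

/-- The vertex set of the component `T_{v_i}` of `G - E(C)` that contains `v_i`. -/
def treeAt {g : ℕ} (v : ZMod g → V) (i : ZMod g) : Set V :=
  {x | (G.deleteEdges {e | ∃ j, e = s(v j, v (j + 1))}).Reachable (v i) x}

variable [Fintype V] [DecidableRel G.Adj]

/-- The set `Q_{v_i}` of the leaves of `G` in the component `T` at the antipode of `v_i`. -/
def antipodalLeaves {g : ℕ} (v : ZMod g → V) (i : ZMod g) : Set V :=
  {x | G.degree x = 1 ∧ x ∈ G.treeAt v (antipode i)}

/-- The indices of the vertices in `D_2(C)`: the vertex and its antipode both have degree two. -/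
def indexD2 {g : ℕ} [NeZero g] (v : ZMod g → V) : Finset (ZMod g) :=
  Finset.univ.filter fun i => G.degree (v i) = 2 ∧ G.degree (v (antipode i)) = 2

/-- The indices of the vertices in `D_{>2}(C)`: the vertex and its antipode both have degree
larger than two. -/
def indexDgt2 {g : ℕ} [NeZero g] (v : ZMod g → V) : Finset (ZMod g) :=
  Finset.univ.filter fun i => 2 < G.degree (v i) ∧ 2 < G.degree (v (antipode i))

end Unicyclic

end SimpleGraph

/-! Strong resolving sets are exactly the vertex covers of the graph of mutually maximally distant
pairs (`Connected.isStrongResolvingSet_iff`): such a pair is resolved only by its own ends, and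
every geodesic extends to one between such ends. Forced vertices are thus those lying in every
minimum cover.

In a unicyclic graph every edge off the cycle is a bridge, so only leaves and cycle vertices of
degree two can be maximally distant from anything. A leaf is maximally distant from every other
vertex; for even length, a cycle vertex of degree two is so only from the vertices of the branch at
its antipode. Hence the graph to be covered consists of a clique on the leaves, an edge from each
leaf to the cycle vertex opposite its branch (its partner) when that vertex has degree two, and a
matching on `D_2` (`IsUnicyclic.isStrongResolvingSet_iff`).

A cover misses at most one leaf, and missing a leaf with a partner costs that partner. If `D_{>2}`
is empty, every leaf has a partner, so missing any one leaf or none costs the same and nothing is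
forced. Otherwise some leaf has no partner; minimum covers must miss such a leaf, so all leaves with
a partner are forced, while any leaf without one may be the one missed. No other vertex is ever
indispensable. -/

namespace SimpleGraph

/-! ### Mutually maximally distant pairs, vertex covers and bridges -/

section MaximallyDistant

variable {V : Type*} {G : SimpleGraph V}

/-- No neighbour of `x` is farther from `y` than `x` is. -/
def IsMaximallyDistant (G : SimpleGraph V) (x y : V) : Prop :=
  ∀ z, G.Adj x z → G.dist z y ≤ G.dist x y

theorem Connected.exists_adj_dist_add_one_eq (hG : G.Connected) {w y : V} (h : w ≠ y) :
    ∃ z, G.Adj y z ∧ G.dist z w + 1 = G.dist y w := by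
  obtain ⟨p, hp⟩ := hG.exists_walk_length_eq_dist y w
  cases p with
  | nil => exact absurd rfl h
  | @cons _ z _ hz q =>
    refine ⟨z, hz, ?_⟩
    have h1 := dist_le q
    have h2 := hG.dist_triangle (u := y) (v := z) (w := w)
    rw [dist_eq_one_iff_adj.2 hz] at h2
    rw [Walk.length_cons] at hp
    omega

/-- If a geodesic from `w` to one end passed through the other, its next vertex towards `w` would be
a neighbour of that other end, farther from the first end. -/
theorem Connected.eq_or_eq_of_stronglyResolves (hG : G.Connected) {w x y : V}
    (hx : G.IsMaximallyDistant x y) (hy : G.IsMaximallyDistant y x)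
    (hw : G.StronglyResolves w x y) : w = x ∨ w = y := by
  by_contra! hne
  rcases hw with hw | hw
  · obtain ⟨z, hz, hzd⟩ := hG.exists_adj_dist_add_one_eq hne.2
    have h1 := hy z hz
    have h2 := hG.dist_triangle (u := w) (v := z) (w := x)
    rw [dist_comm (u := w) (v := z)] at h2
    rw [dist_comm (u := w) (v := y)] at hw
    omega
  · obtain ⟨z, hz, hzd⟩ := hG.exists_adj_dist_add_one_eq hne.1
    have h1 := hx z hz
    have h2 := hG.dist_triangle (u := w) (v := z) (w := y)
    rw [dist_comm (u := w) (v := z)] at h2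
    rw [dist_comm (u := w) (v := x)] at hw
    omega

/-- Every geodesic extends to one whose ends are mutually maximally distant. -/
theorem Connected.exists_isMaximallyDistant_extension [Finite V] (hG : G.Connected) (x y : V) :
    ∃ a b, G.IsMaximallyDistant a b ∧ G.IsMaximallyDistant b a ∧
      G.dist a b = G.dist a x + G.dist x y + G.dist y b := by
  -- Take a longest extension: a farther neighbour of either end would lengthen it.
  obtain ⟨⟨a, b⟩, hab, hmax⟩ := Set.exists_max_image
    {p : V × V | G.dist p.1 p.2 = G.dist p.1 x + G.dist x y + G.dist y p.2}
    (fun p => G.dist p.1 p.2) (Set.toFinite _) ⟨(x, y), by simp⟩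
  simp only [Set.mem_ofPred_eq, Prod.forall] at hab hmax
  refine ⟨a, b, fun z hz => ?_, fun z hz => ?_, hab⟩
  · by_contra! hlt
    have h1 := hG.dist_triangle (u := z) (v := a) (w := x)
    have h2 := hG.dist_triangle (u := z) (v := x) (w := b)
    have h3 := hG.dist_triangle (u := x) (v := y) (w := b)
    rw [dist_eq_one_iff_adj.2 hz.symm] at h1
    have := hmax z b (by omega)
    omega
  · rw [dist_comm (u := z), dist_comm (u := b)]
    by_contra! hlt
    have h1 := hG.dist_triangle (u := y) (v := b) (w := z)
    have h2 := hG.dist_triangle (u := a) (v := y) (w := z)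
    have h3 := hG.dist_triangle (u := a) (v := x) (w := y)
    rw [dist_eq_one_iff_adj.2 hz] at h1
    have := hmax a z (by omega)
    omega

/-- Strong resolving sets are the vertex covers of the graph of mutually maximally distant
pairs. -/
theorem Connected.isStrongResolvingSet_iff [Finite V] (hG : G.Connected) {S : Finset V} :
    G.IsStrongResolvingSet S ↔ ∀ x y, x ≠ y → G.IsMaximallyDistant x y →
      G.IsMaximallyDistant y x → x ∈ S ∨ y ∈ S := by
  constructor
  · intro hS x y hne hx hy
    obtain ⟨w, hw, hwr⟩ := hS x y hne
    rcases hG.eq_or_eq_of_stronglyResolves hx hy hwr with rfl | rfl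
    · exact Or.inl hw
    · exact Or.inr hw
  · intro hS x y hne
    -- Either end of a geodesic through `x` and `y` resolves them, and `S` contains one of the ends.
    obtain ⟨a, b, ha, hb, hab⟩ := hG.exists_isMaximallyDistant_extension x y
    have hpos := hG.pos_dist_of_ne hne
    have h1 := hG.dist_triangle (u := a) (v := x) (w := y)
    have h2 := hG.dist_triangle (u := a) (v := y) (w := b)
    have h3 := hG.dist_triangle (u := x) (v := y) (w := b)
    have h4 := hG.dist_triangle (u := a) (v := x) (w := b)
    rcases hS a b (by rintro rfl; simp at hab; omega) ha hb with h | h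
    · exact ⟨a, h, Or.inr (by omega)⟩
    · refine ⟨b, h, Or.inl ?_⟩
      rw [dist_comm (u := b), dist_comm (u := b), dist_comm (u := y) (v := x)]
      omega

theorem Connected.isMaximallyDistant_of_degree_eq_one (hG : G.Connected) {x y : V}
    [Fintype (G.neighborSet x)] (hx : G.degree x = 1) (hne : y ≠ x) :
    G.IsMaximallyDistant x y := by
  intro z hz
  obtain ⟨w, hw, hwd⟩ := hG.exists_adj_dist_add_one_eq hne
  rw [(degree_eq_one_iff_existsUnique_adj.1 hx).unique hz hw]
  omega

theorem Connected.dist_of_isBridge (hG : G.Connected) {x z a b : V} (hxz : G.Adj x z)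
    (hb : G.IsBridge s(x, z)) (ha : (G.deleteEdges {s(x, z)}).Reachable z a)
    (hy : (G.deleteEdges {s(x, z)}).Reachable x b) :
    G.dist a b = G.dist a z + 1 + G.dist x b := by
  apply le_antisymm
  · have h1 := hG.dist_triangle (u := a) (v := z) (w := b)
    have h2 := hG.dist_triangle (u := z) (v := x) (w := b)
    rw [dist_eq_one_iff_adj.2 hxz.symm] at h2
    omega
  · obtain ⟨p, hp⟩ := hG.exists_walk_length_eq_dist a b
    rw [← hp]
    clear hp
    -- Every walk from `a` to `b`, not only a geodesic, has at least this length; it must cross the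
    -- bridge from `z` to `x`.
    induction p with
    | nil => exact absurd (hy.trans ha.symm) hb
    | @cons a c b hac q ih =>
      rw [Walk.length_cons]
      by_cases he : s(a, c) = s(x, z)
      · rcases Sym2.eq_iff.1 he with ⟨rfl, rfl⟩ | ⟨rfl, rfl⟩
        · exact absurd ha.symm hb
        · have := dist_le q
          rw [dist_self]
          omega
      · have hac' : (G.deleteEdges {s(x, z)}).Adj a c := by
          rw [deleteEdges_adj]
          exact ⟨hac, he⟩
        have := ih (ha.trans hac'.reachable) hy
        have h1 := hG.dist_triangle (u := a) (v := c) (w := z)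
        rw [dist_eq_one_iff_adj.2 hac] at h1
        omega

theorem Connected.reachable_deleteEdges_or (hG : G.Connected) (x z y : V) :
    (G.deleteEdges {s(x, z)}).Reachable x y ∨ (G.deleteEdges {s(x, z)}).Reachable z y := by
  obtain ⟨p⟩ := hG y x
  induction p with
  | nil => exact Or.inl (Reachable.refl _)
  | @cons a c b hac q ih =>
    by_cases he : s(a, c) = s(b, z)
    · rcases Sym2.eq_iff.1 he with ⟨rfl, rfl⟩ | ⟨rfl, rfl⟩
      · exact Or.inl (Reachable.refl _)
      · exact Or.inr (Reachable.refl _)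
    · have hac' : (G.deleteEdges {s(b, z)}).Adj a c := by
        rw [deleteEdges_adj]
        exact ⟨hac, he⟩
      exact ih.imp (·.trans hac'.symm.reachable) (·.trans hac'.symm.reachable)

/-- If `y` is on the side of `x`, moving to `z` increases the distance. If `y` is on the side of
`z`, moving to `w` does, since `w` stays on the side of `x`. -/
theorem Connected.not_isMaximallyDistant_of_isBridge (hG : G.Connected) {x z w : V}
    (hxz : G.Adj x z) (hb : G.IsBridge s(x, z)) (hxw : G.Adj x w) (hne : w ≠ z) (y : V) :
    ¬ G.IsMaximallyDistant x y := by
  intro h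
  rcases hG.reachable_deleteEdges_or x z y with hy | hy
  · have h1 := h z hxz
    rw [hG.dist_of_isBridge hxz hb (Reachable.refl _) hy, dist_self] at h1
    omega
  · have h1 := h w hxw
    have hb' : G.IsBridge s(z, x) := by rwa [Sym2.eq_swap]
    rw [Sym2.eq_swap] at hy
    have hxw' : (G.deleteEdges {s(z, x)}).Adj x w := by
      rw [deleteEdges_adj]
      refine ⟨hxw, fun he => ?_⟩
      rcases Sym2.eq_iff.1 he with ⟨rfl, rfl⟩ | ⟨_, rfl⟩
      · exact hxz.ne rfl
      · exact hne rfl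
    rw [hG.dist_of_isBridge hxz.symm hb' (Reachable.refl _) hy,
      hG.dist_of_isBridge hxz.symm hb' hxw'.reachable hy, dist_self,
      dist_eq_one_iff_adj.2 hxw.symm] at h1
    omega

/-- The form in which all exchange arguments are used: a resolving set no larger than a basis is a
basis. -/
theorem IsStrongMetricBasis.notMem_forced {S T : Finset V} {x : V} (hS : G.IsStrongMetricBasis S)
    (hT : G.IsStrongResolvingSet T) (hc : T.card ≤ S.card) (hx : x ∉ T) :
    x ∉ G.strongBasisForced :=
  fun h => hx (h T ⟨hT, fun U hU => hc.trans (hS.2 U hU)⟩)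

end MaximallyDistant

end SimpleGraph

namespace SimpleGraph

/-! ### Antipodes and cyclic distance in `ZMod g` -/

section CyclicIndices

variable {g : ℕ}

theorem antipode_antipode (hg : Even g) (i : ZMod g) : antipode (antipode i) = i := by
  obtain ⟨m, rfl⟩ := hg
  have h : (m + m) / 2 = m := by omega
  have h2 : ((m + m : ℕ) : ZMod (m + m)) = 0 := ZMod.natCast_self _
  rw [antipode, antipode, h, add_assoc, ← Nat.cast_add, h2, add_zero]

theorem natCast_half_ne_zero (hg : 3 ≤ g) : ((g / 2 : ℕ) : ZMod g) ≠ 0 := by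
  rw [Ne, ZMod.natCast_eq_zero_iff]
  exact fun h => absurd (Nat.le_of_dvd (by omega) h) (by omega)

theorem add_natCast_ne (i : ZMod g) {m n : ℕ} (h : m < n) (hn : n < g) :
    i + m ≠ i + n := by
  intro he
  rw [add_right_inj, ZMod.natCast_eq_natCast_iff', Nat.mod_eq_of_lt (by omega),
    Nat.mod_eq_of_lt hn] at he
  omega

theorem antipode_ne (hg : 3 ≤ g) (i : ZMod g) : antipode i ≠ i := by
  rw [antipode, Ne, add_eq_left]
  exact natCast_half_ne_zero hg

theorem natAbs_valMinAbs_le_add_one (hg : 3 ≤ g) (a : ZMod g) :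
    a.valMinAbs.natAbs ≤ (a + 1).valMinAbs.natAbs + 1 := by
  have h := ZMod.natAbs_valMinAbs_add_le (a + 1) (-1)
  rw [add_neg_cancel_right] at h
  have h1 : (-1 : ZMod g).valMinAbs.natAbs = 1 := by
    rw [ZMod.natAbs_valMinAbs_neg]
    have := ZMod.valMinAbs_natCast_of_le_half (n := g) (a := 1) (by omega)
    rw [Nat.cast_one] at this
    rw [this]; rfl
  have := Int.natAbs_add_le (a + 1).valMinAbs (-1 : ZMod g).valMinAbs
  omega

theorem natAbs_valMinAbs_le_sub_one (hg : 3 ≤ g) (a : ZMod g) :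
    a.valMinAbs.natAbs ≤ (a - 1).valMinAbs.natAbs + 1 := by
  have h := natAbs_valMinAbs_le_add_one hg (-a)
  rw [ZMod.natAbs_valMinAbs_neg] at h
  rwa [← ZMod.natAbs_valMinAbs_neg (a - 1), neg_sub, sub_eq_neg_add]

theorem val_add_one_of_lt [NeZero g] {a : ZMod g} (h : a.val + 1 < g) :
    (a + 1).val = a.val + 1 := by
  conv_lhs => rw [← ZMod.natCast_zmod_val a]
  rw [← Nat.cast_succ, ZMod.val_natCast, Nat.mod_eq_of_lt h]

theorem val_sub_one_of_pos [NeZero g] {a : ZMod g} (h : 0 < a.val) :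
    (a - 1).val = a.val - 1 := by
  have hlt := ZMod.val_lt a
  have h1 : a - 1 = ((a.val - 1 : ℕ) : ZMod g) := by
    rw [Nat.cast_sub h, ZMod.natCast_zmod_val, Nat.cast_one]
  rw [h1, ZMod.val_natCast, Nat.mod_eq_of_lt (by omega)]

/-- On a cycle of even length, only the point opposite to the origin is a local maximum of the
distance to the origin. -/
theorem natAbs_valMinAbs_local_max_iff [NeZero g] (hg : Even g) (a : ZMod g) :
    ((a + 1).valMinAbs.natAbs ≤ a.valMinAbs.natAbs ∧
      (a - 1).valMinAbs.natAbs ≤ a.valMinAbs.natAbs) ↔ a = ((g / 2 : ℕ) : ZMod g) := by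
  have hg0 := NeZero.ne g
  obtain ⟨m, hm⟩ := hg
  constructor
  · rintro ⟨h1, h2⟩
    rw [← ZMod.natCast_zmod_val a]
    congr 1
    have hlt := ZMod.val_lt a
    rw [ZMod.valMinAbs_natAbs_eq_min, ZMod.valMinAbs_natAbs_eq_min] at h1 h2
    by_contra hne
    -- Below the midpoint a step up increases the cyclic distance; above it a step down does.
    rcases lt_or_gt_of_ne hne with h | h
    · rw [val_add_one_of_lt (by omega)] at h1
      omega
    · rw [val_sub_one_of_pos (by omega)] at h2
      omega
  · rintro rfl
    rw [ZMod.valMinAbs_natCast_of_le_half le_rfl, Int.natAbs_natCast]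
    exact ⟨ZMod.natAbs_valMinAbs_le _, ZMod.natAbs_valMinAbs_le _⟩

end CyclicIndices

/-! ### Branches at the cycle and the distance formula -/

section CycleLabelling

variable {V : Type*} {G : SimpleGraph V} {g : ℕ} {v : ZMod g → V}

/-- The graph is arbitrary so that the arc can be followed after deleting edges outside it. -/
theorem reachable_arc {H : SimpleGraph V} (v : ZMod g → V) (i : ZMod g) (m : ℕ)
    (h : ∀ n < m, H.Adj (v (i + n)) (v (i + n + 1))) : H.Reachable (v i) (v (i + m)) := by
  induction m with
  | zero => simp
  | succ m ih =>
    have := (ih fun n hn => h n (by omega)).trans (h m (by omega)).reachable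
    rwa [add_assoc, ← Nat.cast_succ] at this

namespace IsCycleLabelling

theorem edge_injective (hv : G.IsCycleLabelling v) {i j : ZMod g}
    (h : s(v i, v (i + 1)) = s(v j, v (j + 1))) : i = j := by
  rcases Sym2.eq_iff.1 h with ⟨h1, _⟩ | ⟨h1, h2⟩
  · exact hv.injective h1
  · have h1 := hv.injective h1
    have h2 := hv.injective h2
    exfalso
    have h3 : ((2 : ℕ) : ZMod g) = 0 := by
      rw [h1, add_assoc, add_eq_left] at h2
      rw [← h2]; norm_num
    rw [ZMod.natCast_eq_zero_iff] at h3
    have := Nat.le_of_dvd (by norm_num) h3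
    have := hv.three_le
    omega

theorem adj_sub_one (hv : G.IsCycleLabelling v) (j : ZMod g) : G.Adj (v j) (v (j - 1)) := by
  have := hv.adj (j - 1)
  rw [sub_add_cancel] at this
  exact this.symm

theorem add_one_ne_sub_one (hv : G.IsCycleLabelling v) (j : ZMod g) :
    v (j + 1) ≠ v (j - 1) := by
  intro h
  have h := hv.injective h
  have h3 := hv.three_le
  apply add_natCast_ne (j - 1) (m := 0) (n := 2) (by omega) (by omega)
  push_cast
  linear_combination -h

theorem not_isBridge (hv : G.IsCycleLabelling v) (k : ZMod g) :
    ¬ G.IsBridge s(v k, v (k + 1)) := by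
  rw [isBridge_iff, not_not]
  have h3 := hv.three_le
  have h := reachable_arc (H := G.deleteEdges {s(v k, v (k + 1))}) v (k + 1) (g - 1) ?_
  · rw [add_assoc, ← Nat.cast_one, ← Nat.cast_add, Nat.add_sub_cancel' (by omega),
      ZMod.natCast_self, add_zero, Nat.cast_one] at h
    exact h.symm
  · intro n hn
    rw [deleteEdges_adj]
    refine ⟨hv.adj _, fun he => ?_⟩
    have := hv.edge_injective he
    have h0 := add_natCast_ne k (m := 0) (n := n + 1) (by omega) (by omega)
    apply h0
    push_cast
    linear_combination -this

end IsCycleLabelling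

/-- An edge that is not a bridge lies on a cycle. A cycle surviving its deletion would be that same
unique cycle, hence would still contain the edge. -/
theorem IsUnicyclic.isAcyclic_deleteEdges (hG : G.IsUnicyclic) {e : Sym2 V} (he : e ∈ G.edgeSet)
    (hb : ¬ G.IsBridge e) : (G.deleteEdges {e}).IsAcyclic := by
  rw [isBridge_iff_forall_cycle_notMem he] at hb
  push Not at hb
  obtain ⟨u, p, hp, hep⟩ := hb
  intro w q hq
  have hle : G.deleteEdges {e} ≤ G := deleteEdges_le _
  obtain ⟨C, _, hC⟩ := hG.2
  have h1 := hC _ ⟨u, p, hp, rfl⟩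
  have h2 := hC _ ⟨w, q.mapLe hle, hq.mapLe hle, rfl⟩
  have h3 : e ∈ (q.mapLe hle).edges := by
    rw [← Walk.mem_edges_toSubgraph, h2, ← h1, Walk.mem_edges_toSubgraph]
    exact hep
  rw [Walk.edges_mapLe_eq_edges] at h3
  have := q.edges_subset_edgeSet h3
  simp at this

/-- The graph `G - E(C)`. -/
abbrev deleteCycle (G : SimpleGraph V) (v : ZMod g → V) : SimpleGraph V :=
  G.deleteEdges {e | ∃ j, e = s(v j, v (j + 1))}

theorem deleteCycle_adj_or (v : ZMod g → V) {a b : V} (h : G.Adj a b) :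
    (G.deleteCycle v).Adj a b ∨
      ∃ j, (a = v j ∧ b = v (j + 1)) ∨ (a = v (j + 1) ∧ b = v j) := by
  by_cases he : ∃ j, s(a, b) = s(v j, v (j + 1))
  · obtain ⟨j, hj⟩ := he
    exact Or.inr ⟨j, Sym2.eq_iff.1 hj⟩
  · left
    rw [deleteEdges_adj]
    exact ⟨h, he⟩

theorem mem_treeAt_iff {i : ZMod g} {x : V} :
    x ∈ G.treeAt v i ↔ (G.deleteCycle v).Reachable (v i) x := Iff.rfl

theorem Connected.exists_mem_treeAt (hG : G.Connected) (v : ZMod g → V) (x : V) :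
    ∃ i, x ∈ G.treeAt v i := by
  simp only [mem_treeAt_iff]
  obtain ⟨p⟩ := hG x (v 0)
  generalize hb : v 0 = b at p
  induction p with
  | nil => exact ⟨0, hb ▸ Reachable.refl _⟩
  | cons hac q ih =>
    rcases deleteCycle_adj_or v hac with h | ⟨j, ⟨rfl, _⟩ | ⟨rfl, _⟩⟩
    · exact (ih hb).imp fun i hi => hi.trans h.symm.reachable
    · exact ⟨j, Reachable.refl _⟩
    · exact ⟨j + 1, Reachable.refl _⟩

namespace IsUnicyclic

/-- Deleting a non-bridge would leave an acyclic graph, yet the labelled cycle avoids this edge and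
survives. -/
theorem isBridge_of_deleteCycle_adj (hG : G.IsUnicyclic) (hv : G.IsCycleLabelling v) {x z : V}
    (h : (G.deleteCycle v).Adj x z) : G.IsBridge s(x, z) := by
  rw [deleteEdges_adj] at h
  by_contra hb
  have hac := hG.isAcyclic_deleteEdges h.1 hb
  have hv' : (G.deleteEdges {s(x, z)}).IsCycleLabelling v :=
    ⟨hv.three_le, hv.injective, fun i => by
      rw [deleteEdges_adj]
      exact ⟨hv.adj i, fun he => h.2 ⟨i, he.symm⟩⟩⟩
  exact hv'.not_isBridge 0 (isAcyclic_iff_forall_adj_isBridge.1 hac (hv'.adj 0))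

/-- Without the cycle edge entering `v i` the graph is a forest, so the cycle edge leaving `v i` is
a bridge there. A connection from `v i` to another `v j` off the cycle, followed by the arc back to
`v (i + 1)`, would bypass that bridge. -/
theorem treeAt_index_unique (hG : G.IsUnicyclic) (hv : G.IsCycleLabelling v) {i j : ZMod g}
    (h : v j ∈ G.treeAt v i) : i = j := by
  have h3 := hv.three_le
  have : NeZero g := ⟨by omega⟩
  by_contra hne
  have hadj := hv.adj (i - 1)
  have hac := hG.isAcyclic_deleteEdges hadj (hv.not_isBridge (i - 1))
  set F := G.deleteEdges {s(v (i - 1), v (i - 1 + 1))} with hF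
  have hFadj : ∀ k, k ≠ i - 1 → F.Adj (v k) (v (k + 1)) := fun k hk => by
    rw [hF, deleteEdges_adj]
    exact ⟨hv.adj k, fun he => hk (hv.edge_injective he)⟩
  have hi1 : i ≠ i - 1 := by
    intro h
    have := add_natCast_ne (i - 1) (m := 0) (n := 1) (by omega) (by omega)
    apply this; simpa using h.symm
  have hb := isAcyclic_iff_forall_adj_isBridge.1 hac (hFadj i hi1)
  rw [isBridge_iff] at hb
  apply hb
  have hle : G.deleteCycle v ≤ F.deleteEdges {s(v i, v (i + 1))} := by
    rw [hF, deleteEdges_deleteEdges]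
    apply deleteEdges_anti
    rintro e (rfl | rfl)
    · exact ⟨i - 1, rfl⟩
    · exact ⟨i, rfl⟩
  refine (Reachable.mono hle h).trans (Reachable.symm ?_)
  have hr := reachable_arc (H := F.deleteEdges {s(v i, v (i + 1))}) v (i + 1) (j - (i + 1)).val ?_
  · rwa [ZMod.natCast_zmod_val, add_sub_cancel] at hr
  · intro n hn
    have hlt := ZMod.val_lt (j - (i + 1))
    -- An arc of length `g - 1` from `i + 1` ends at `i`; as `j ≠ i`, the arc stops before the edge
    -- entering `v i`.
    have hval : (j - (i + 1)).val ≠ g - 1 := by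
      intro he
      apply hne
      have h1 := ZMod.natCast_zmod_val (j - (i + 1))
      rw [he, Nat.cast_sub (by omega), ZMod.natCast_self] at h1
      push_cast at h1
      linear_combination h1
    rw [deleteEdges_adj]
    refine ⟨hFadj _ fun he => ?_, fun he => ?_⟩
    · apply add_natCast_ne (i - 1) (m := 0) (n := n + 2) (by omega) (by omega)
      push_cast
      linear_combination -he
    · have he := hv.edge_injective he
      apply add_natCast_ne i (m := 0) (n := n + 1) (by omega) (by omega)
      push_cast
      linear_combination -he

theorem treeAt_eq_of_mem (hG : G.IsUnicyclic) (hv : G.IsCycleLabelling v) {i j : ZMod g} {x : V}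
    (hi : x ∈ G.treeAt v i) (hj : x ∈ G.treeAt v j) : i = j :=
  hG.treeAt_index_unique hv (Reachable.trans hi (Reachable.symm hj))

/-- The left side, with `i` the index of the branch containing the current vertex, drops by at most
one along each edge of a walk to `v k`, where it is zero. -/
theorem dist_ge (hG : G.IsUnicyclic) (hv : G.IsCycleLabelling v) {i k : ZMod g} {a : V}
    (ha : a ∈ G.treeAt v i) :
    G.dist a (v i) + (k - i).valMinAbs.natAbs ≤ G.dist a (v k) := by
  have h3 := hv.three_le
  obtain ⟨p, hp⟩ := hG.1.exists_walk_length_eq_dist a (v k)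
  rw [← hp]
  clear hp
  generalize hb : v k = b at p
  induction p generalizing i with
  | nil =>
    subst hb
    obtain rfl := hG.treeAt_index_unique hv ha
    simp
  | cons hac q ih =>
    rw [Walk.length_cons]
    rcases deleteCycle_adj_or v hac with h | ⟨j, ⟨rfl, rfl⟩ | ⟨rfl, rfl⟩⟩
    · have h1 := ih (ha.trans h.reachable) hb
      have h2 := hG.1.dist_triangle (u := _) (v := _) (w := v i) |>.trans_eq
        (congrArg (· + _) (dist_eq_one_iff_adj.2 hac))
      omega
    · obtain rfl := hG.treeAt_index_unique hv ha
      have h1 := ih (i := i + 1) (Reachable.refl _) hb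
      have h2 := natAbs_valMinAbs_le_sub_one h3 (k - i)
      rw [sub_sub] at h2
      rw [dist_self] at h1 ⊢
      omega
    · obtain rfl := hG.treeAt_index_unique hv ha
      have h1 := ih (i := j) (Reachable.refl _) hb
      have h2 := natAbs_valMinAbs_le_add_one h3 (k - (j + 1))
      have h4 : k - (j + 1) + 1 = k - j := by ring
      rw [h4] at h2
      rw [dist_self] at h1 ⊢
      omega

end IsUnicyclic

theorem IsCycleLabelling.dist_add_natCast_le (hG : G.Connected) (hv : G.IsCycleLabelling v)
    (i : ZMod g) (n : ℕ) : G.dist (v i) (v (i + n)) ≤ n := by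
  induction n with
  | zero => simp
  | succ n ih =>
    have h := hG.dist_triangle (u := v i) (v := v (i + n)) (w := v (i + n + 1))
    rw [dist_eq_one_iff_adj.2 (hv.adj _)] at h
    rw [Nat.cast_succ, ← add_assoc]
    omega

theorem IsCycleLabelling.dist_le (hG : G.Connected) (hv : G.IsCycleLabelling v) (i k : ZMod g) :
    G.dist (v i) (v k) ≤ (k - i).valMinAbs.natAbs := by
  have h3 := hv.three_le
  have : NeZero g := ⟨by omega⟩
  have h1 := hv.dist_add_natCast_le hG i (k - i).val
  have h2 := hv.dist_add_natCast_le hG k (i - k).val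
  rw [ZMod.natCast_zmod_val, add_sub_cancel] at h1 h2
  rw [ZMod.valMinAbs_natAbs_eq_min]
  refine le_min h1 ?_
  by_cases h : k - i = 0
  · rw [sub_eq_zero] at h
    simp [h]
  · rw [dist_comm]
    have : NeZero (k - i) := ⟨h⟩
    rw [← neg_sub k i, ZMod.val_neg_of_ne_zero] at h2
    exact h2

theorem IsUnicyclic.dist_eq (hG : G.IsUnicyclic) (hv : G.IsCycleLabelling v) {i : ZMod g} {y : V}
    (hy : y ∈ G.treeAt v i) (k : ZMod g) :
    G.dist (v k) y = G.dist (v i) y + (k - i).valMinAbs.natAbs := by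
  have h1 := hG.dist_ge hv hy (k := k)
  have h2 := hv.dist_le hG.1 i k
  have h3 := hG.1.dist_triangle (u := y) (v := v i) (w := v k)
  rw [dist_comm (v := y), dist_comm (v := y)]
  omega

end CycleLabelling

end SimpleGraph

namespace SimpleGraph

/-! ### Leaves, degree-two cycle vertices and the graph to be covered -/

section Unicyclic

variable {V : Type*} [Fintype V] {G : SimpleGraph V} [DecidableRel G.Adj] {g : ℕ}
  {v : ZMod g → V}

namespace IsCycleLabelling

theorem two_le_degree (hv : G.IsCycleLabelling v) (j : ZMod g) : 2 ≤ G.degree (v j) := by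
  classical
  rw [← card_neighborFinset_eq_degree, ← Finset.card_pair (hv.add_one_ne_sub_one j)]
  apply Finset.card_le_card
  simp [Finset.insert_subset_iff, hv.adj j, hv.adj_sub_one j]

theorem eq_or_eq_of_degree_eq_two (hv : G.IsCycleLabelling v) {j : ZMod g}
    (hd : G.degree (v j) = 2) {z : V} (hz : G.Adj (v j) z) :
    z = v (j + 1) ∨ z = v (j - 1) := by
  classical
  have h : {v (j + 1), v (j - 1)} = G.neighborFinset (v j) := by
    apply Finset.eq_of_subset_of_card_le
    · simp [Finset.insert_subset_iff, hv.adj j, hv.adj_sub_one j]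
    · rw [card_neighborFinset_eq_degree, hd, Finset.card_pair (hv.add_one_ne_sub_one j)]
  have hz' : z ∈ G.neighborFinset (v j) := by simpa using hz
  simpa [← h] using hz'

theorem degree_eq_two_iff (hv : G.IsCycleLabelling v) {j : ZMod g} :
    G.degree (v j) = 2 ↔ ∀ z, ¬ (G.deleteCycle v).Adj (v j) z := by
  classical
  constructor
  · intro hd z hz
    rw [deleteEdges_adj] at hz
    rcases hv.eq_or_eq_of_degree_eq_two hd hz.1 with rfl | rfl
    · exact hz.2 ⟨j, rfl⟩
    · exact hz.2 ⟨j - 1, by rw [sub_add_cancel, Sym2.eq_swap]⟩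
  · intro h
    refine le_antisymm ?_ (hv.two_le_degree j)
    rw [← card_neighborFinset_eq_degree, ← Finset.card_pair (hv.add_one_ne_sub_one j)]
    apply Finset.card_le_card
    intro z hz
    rw [mem_neighborFinset] at hz
    rcases (deleteCycle_adj_or v hz).resolve_left (h z) with ⟨k, ⟨hk, rfl⟩ | ⟨hk, rfl⟩⟩
    · rw [hv.injective hk]; simp
    · rw [hv.injective hk]; simp

theorem eq_of_mem_treeAt (hv : G.IsCycleLabelling v) {j : ZMod g} {x : V}
    (hd : G.degree (v j) = 2) (hx : x ∈ G.treeAt v j) : x = v j := by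
  obtain ⟨p⟩ := mem_treeAt_iff.1 hx
  cases p with
  | nil => rfl
  | cons h _ => exact absurd h (hv.degree_eq_two_iff.1 hd _)

theorem ne_of_degree_eq_one (hv : G.IsCycleLabelling v) {x : V} (hx : G.degree x = 1)
    (j : ZMod g) : x ≠ v j := by
  rintro rfl
  have := hv.two_le_degree j
  omega

theorem two_lt_degree_of_mem_treeAt (hv : G.IsCycleLabelling v) {j : ZMod g} {x : V}
    (hx : G.degree x = 1) (hxj : x ∈ G.treeAt v j) : 2 < G.degree (v j) := by
  have h2 := hv.two_le_degree j
  by_contra h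
  exact hv.ne_of_degree_eq_one hx j (hv.eq_of_mem_treeAt (by omega) hxj)

end IsCycleLabelling

theorem exists_adj_ne_of_degree_ne_one {x z : V} (hz : G.Adj x z) (hx : G.degree x ≠ 1) :
    ∃ w, G.Adj x w ∧ w ≠ z := by
  by_contra! h
  exact hx (degree_eq_one_iff_existsUnique_adj.2 ⟨z, hz, h⟩)

namespace IsUnicyclic

/-- An edge off the cycle is a bridge, so its end can be maximally distant only as a leaf. A vertex
with no such edge is a cycle vertex with trivial branch. -/
theorem degree_of_isMaximallyDistant (hG : G.IsUnicyclic) (hv : G.IsCycleLabelling v) {x y : V}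
    (h : G.IsMaximallyDistant x y) : G.degree x = 1 ∨ ∃ j, x = v j ∧ G.degree (v j) = 2 := by
  by_cases hz : ∃ z, (G.deleteCycle v).Adj x z
  · obtain ⟨z, hz⟩ := hz
    have hz' : G.Adj x z := deleteEdges_le _ hz
    by_contra! hd
    obtain ⟨w, hw, hne⟩ := exists_adj_ne_of_degree_ne_one hz' hd.1
    exact hG.1.not_isMaximallyDistant_of_isBridge hz' (hG.isBridge_of_deleteCycle_adj hv hz)
      hw hne y h
  · push Not at hz
    obtain ⟨i, hi⟩ := hG.1.exists_mem_treeAt v x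
    obtain ⟨p⟩ := (mem_treeAt_iff.1 hi).symm
    cases p with
    | nil => exact Or.inr ⟨i, rfl, hv.degree_eq_two_iff.2 hz⟩
    | cons h _ => exact absurd h (hz _)

/-- By the distance formula, the distance from a cycle vertex to `y` is a constant plus the cyclic
distance to `i`, whose only local maximum is at the antipode. -/
theorem isMaximallyDistant_cycle_iff [NeZero g] (hG : G.IsUnicyclic) (hg : Even g)
    (hv : G.IsCycleLabelling v) {i j : ZMod g} {y : V} (hd : G.degree (v j) = 2)
    (hy : y ∈ G.treeAt v i) : G.IsMaximallyDistant (v j) y ↔ j = antipode i := by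
  have h : G.IsMaximallyDistant (v j) y ↔
      G.dist (v (j + 1)) y ≤ G.dist (v j) y ∧ G.dist (v (j - 1)) y ≤ G.dist (v j) y := by
    refine ⟨fun h => ⟨h _ (hv.adj j), h _ (hv.adj_sub_one j)⟩, fun h z hz => ?_⟩
    rcases hv.eq_or_eq_of_degree_eq_two hd hz with rfl | rfl
    exacts [h.1, h.2]
  rw [h, hG.dist_eq hv hy j, hG.dist_eq hv hy (j + 1), hG.dist_eq hv hy (j - 1),
    add_le_add_iff_left, add_le_add_iff_left, add_sub_right_comm, sub_right_comm j 1 i,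
    natAbs_valMinAbs_local_max_iff hg, sub_eq_iff_eq_add', antipode]

/-- A branch at a cycle vertex of degree larger than two contains a leaf. -/
theorem exists_leaf_mem_treeAt (hG : G.IsUnicyclic) (hv : G.IsCycleLabelling v) {j : ZMod g}
    (hd : 2 < G.degree (v j)) : ∃ x, G.degree x = 1 ∧ x ∈ G.treeAt v j := by
  -- A vertex of the branch farthest from its root is off the cycle, so all its neighbours lie in
  -- the branch and it is maximally distant from the root.
  obtain ⟨x, hx, hmax⟩ := Set.exists_max_image (G.treeAt v j) (fun x => G.dist x (v j))
    (Set.toFinite _) ⟨v j, Reachable.refl _⟩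
  refine ⟨x, ?_, hx⟩
  have hne : x ≠ v j := by
    rintro rfl
    have h2 : ¬ ∀ z, ¬ (G.deleteCycle v).Adj (v j) z := fun h => by
      have := hv.degree_eq_two_iff.2 h
      omega
    push Not at h2
    obtain ⟨z, hz⟩ := h2
    have h1 := hmax z hz.reachable
    have h3 : G.Adj (v j) z := deleteEdges_le _ hz
    rw [dist_eq_one_iff_adj.2 h3.symm, dist_self] at h1
    omega
  have hrange : ∀ k, x ≠ v k := by
    rintro k rfl
    exact hne (by rw [hG.treeAt_index_unique hv hx])
  have hmd : G.IsMaximallyDistant x (v j) := by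
    intro z hz
    rcases deleteCycle_adj_or v hz with h | ⟨k, ⟨h, _⟩ | ⟨h, _⟩⟩
    · exact hmax z (Reachable.trans hx h.reachable)
    · exact absurd h (hrange _)
    · exact absurd h (hrange _)
  rcases hG.degree_of_isMaximallyDistant hv hmd with h | ⟨k, h, _⟩
  · exact h
  · exact absurd h (hrange k)

end IsUnicyclic

/-- The vertex covers of the graph formed by a clique on the leaves, the pairs of a leaf and a
cycle vertex of degree two opposite to its branch, and the pairs of antipodal cycle vertices of
degree two. -/
structure IsAntipodalCover (G : SimpleGraph V) [DecidableRel G.Adj] (v : ZMod g → V)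
    (S : Finset V) : Prop where
  leaf_leaf : ∀ x y, G.degree x = 1 → G.degree y = 1 → x ≠ y → x ∈ S ∨ y ∈ S
  leaf_cycle : ∀ x j, G.degree x = 1 → x ∈ G.treeAt v j → G.degree (v (antipode j)) = 2 →
    x ∈ S ∨ v (antipode j) ∈ S
  cycle_cycle : ∀ j, G.degree (v j) = 2 → G.degree (v (antipode j)) = 2 →
    v j ∈ S ∨ v (antipode j) ∈ S

theorem IsUnicyclic.isStrongResolvingSet_iff [NeZero g] (hG : G.IsUnicyclic) (hg : Even g)
    (hv : G.IsCycleLabelling v) {S : Finset V} :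
    G.IsStrongResolvingSet S ↔ G.IsAntipodalCover v S := by
  have hself : ∀ j, v j ∈ G.treeAt v j := fun j => Reachable.refl _
  rw [hG.1.isStrongResolvingSet_iff]
  constructor
  · intro h
    refine ⟨fun x y hx hy hne => ?_, fun x j hx hxj hj => ?_, fun j hj hj' => ?_⟩
    · exact h x y hne (hG.1.isMaximallyDistant_of_degree_eq_one hx hne.symm)
        (hG.1.isMaximallyDistant_of_degree_eq_one hy hne)
    · have hne := hv.ne_of_degree_eq_one hx (antipode j)
      exact h _ _ hne (hG.1.isMaximallyDistant_of_degree_eq_one hx hne.symm)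
        ((hG.isMaximallyDistant_cycle_iff hg hv hj hxj).2 rfl)
    · refine h _ _ (fun he => antipode_ne hv.three_le j (hv.injective he).symm) ?_ ?_
      · exact (hG.isMaximallyDistant_cycle_iff hg hv hj (hself _)).2 (antipode_antipode hg j).symm
      · exact (hG.isMaximallyDistant_cycle_iff hg hv hj' (hself _)).2 rfl
  · intro h x y hne hx hy
    rcases hG.degree_of_isMaximallyDistant hv hx with hx1 | ⟨i, rfl, hi⟩ <;>
      rcases hG.degree_of_isMaximallyDistant hv hy with hy1 | ⟨j, rfl, hj⟩
    · exact h.leaf_leaf x y hx1 hy1 hne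
    · obtain ⟨i, hi⟩ := hG.1.exists_mem_treeAt v x
      obtain rfl := (hG.isMaximallyDistant_cycle_iff hg hv hj hi).1 hy
      exact h.leaf_cycle x i hx1 hi hj
    · obtain ⟨j, hj⟩ := hG.1.exists_mem_treeAt v y
      obtain rfl := (hG.isMaximallyDistant_cycle_iff hg hv hi hj).1 hx
      exact (h.leaf_cycle y j hy1 hj hi).symm
    · obtain rfl := (hG.isMaximallyDistant_cycle_iff hg hv hj (hself i)).1 hy
      exact h.cycle_cycle i hi hj

/-! ### Exchange arguments in minimum covers -/

section Bases

theorem exists_isStrongMetricBasis (G : SimpleGraph V) : ∃ S, G.IsStrongMetricBasis S := by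
  classical
  obtain ⟨S, hS, hmin⟩ := Finset.exists_min_image
    (Finset.univ.filter fun S : Finset V => G.IsStrongResolvingSet S) Finset.card
    ⟨Finset.univ, by
      simp only [Finset.mem_filter, Finset.mem_univ, true_and]
      exact fun x y _ => ⟨x, Finset.mem_univ _, Or.inr (by simp)⟩⟩
  simp only [Finset.mem_filter, Finset.mem_univ, true_and] at hS hmin
  exact ⟨S, hS, hmin⟩

/-- At most one leaf is missing from a cover; trade `x` for it if there is one. -/
theorem IsAntipodalCover.exists_exchange {S : Finset V} (h : G.IsAntipodalCover v S) {x : V}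
    (hx : x ∈ S) : ∃ T : Finset V, x ∉ T ∧ T.card ≤ S.card ∧ (∀ y ∈ S, y ≠ x → y ∈ T) ∧
      ∀ y, G.degree y = 1 → y ≠ x → y ∈ T := by
  classical
  by_cases hy : ∃ y, G.degree y = 1 ∧ y ∉ S
  · obtain ⟨y, hy1, hyS⟩ := hy
    refine ⟨insert y (S.erase x), ?_, ?_, ?_, fun z hz hzx => ?_⟩
    · grind
    · have := Finset.card_insert_le y (S.erase x)
      have := Finset.card_erase_add_one hx
      omega
    · grind
    · have := h.leaf_leaf y z hy1 hz
      grind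
  · push Not at hy
    refine ⟨S.erase x, by simp, Finset.card_le_card (Finset.erase_subset _ _), ?_, ?_⟩ <;> grind

variable [NeZero g]

/-- A vertex of a degree-two antipodal pair can be swapped with its antipode. For any other non-leaf
`x`, a set containing all leaves no longer needs `x`. -/
theorem IsUnicyclic.notMem_forced_of_degree_ne_one (hG : G.IsUnicyclic) (hg : Even g)
    (hv : G.IsCycleLabelling v) {x : V} (hx : G.degree x ≠ 1) : x ∉ G.strongBasisForced := by
  classical
  obtain ⟨S, hS⟩ := exists_isStrongMetricBasis G
  intro hforced
  have hxS := hforced S hS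
  have hcov := (hG.isStrongResolvingSet_iff hg hv).1 hS.1
  revert hforced
  by_cases hj : ∃ j, x = v j ∧ G.degree (v j) = 2 ∧ G.degree (v (antipode j)) = 2
  · obtain ⟨j, rfl, hj, hj'⟩ := hj
    have hne : v (antipode j) ≠ v j := fun h => antipode_ne hv.three_le j (hv.injective h)
    refine hS.notMem_forced (T := insert (v (antipode j)) (S.erase (v j))) ?_ ?_ ?_
    · rw [hG.isStrongResolvingSet_iff hg hv]
      refine ⟨fun a b ha hb hab => ?_, fun a k ha hak hk => ?_, fun k hk hk' => ?_⟩
      · have := hcov.leaf_leaf a b ha hb hab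
        grind
      · have h1 := hcov.leaf_cycle a k ha hak hk
        have h2 := hv.two_lt_degree_of_mem_treeAt ha hak
        -- The branch opposite `v j` is trivial, so `v j` is the partner of no leaf.
        have h3 : v (antipode k) ≠ v j := fun h => by
          have := hv.injective h
          rw [← this, antipode_antipode hg] at hj'
          omega
        grind
      · have h1 := hcov.cycle_cycle k hk hk'
        by_cases h2 : k = j
        · subst h2; simp
        by_cases h3 : antipode k = j
        · rw [← h3, antipode_antipode hg]; simp
        have h2' := hv.injective.ne h2
        have h3' := hv.injective.ne h3
        grind
    · have := Finset.card_insert_le (v (antipode j)) (S.erase (v j))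
      have := Finset.card_erase_add_one hxS
      omega
    · grind
  · obtain ⟨T, hxT, hcard, hsub, hleaf⟩ := hcov.exists_exchange hxS
    refine hS.notMem_forced (T := T) ?_ hcard hxT
    have hleaf' : ∀ y, G.degree y = 1 → y ∈ T := fun y hy => hleaf y hy (by grind)
    rw [hG.isStrongResolvingSet_iff hg hv]
    refine ⟨fun a b ha hb hab => Or.inl (hleaf' a ha), fun a k ha _ _ => Or.inl (hleaf' a ha),
      fun k hk hk' => ?_⟩
    refine (hcov.cycle_cycle k hk hk').imp (fun h => hsub _ h ?_) (fun h => hsub _ h ?_)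
    · rintro rfl
      exact hj ⟨k, rfl, hk, hk'⟩
    · rintro rfl
      exact hj ⟨_, rfl, hk', by rwa [antipode_antipode hg]⟩

/-- Such a leaf must be covered only against other leaves, so it may be the one omitted. -/
theorem IsUnicyclic.notMem_forced_of_two_lt_degree (hG : G.IsUnicyclic) (hg : Even g)
    (hv : G.IsCycleLabelling v) {x : V} {j : ZMod g} (hx : G.degree x = 1)
    (hxj : x ∈ G.treeAt v j) (hj : 2 < G.degree (v (antipode j))) :
    x ∉ G.strongBasisForced := by
  obtain ⟨S, hS⟩ := exists_isStrongMetricBasis G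
  intro hforced
  have hxS := hforced S hS
  have hcov := (hG.isStrongResolvingSet_iff hg hv).1 hS.1
  obtain ⟨T, hxT, hcard, hsub, hleaf⟩ := hcov.exists_exchange hxS
  refine hS.notMem_forced (T := T) ?_ hcard hxT hforced
  rw [hG.isStrongResolvingSet_iff hg hv]
  refine ⟨fun a b ha hb hab => ?_, fun a k ha hak hk => ?_, fun k hk hk' => ?_⟩
  · by_cases h : a = x
    · exact Or.inr (hleaf b hb (h ▸ hab.symm))
    · exact Or.inl (hleaf a ha h)
  · refine Or.inl (hleaf a ha ?_)
    rintro rfl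
    rw [hG.treeAt_eq_of_mem hv hak hxj] at hk
    omega
  · exact (hcov.cycle_cycle k hk hk').imp
      (fun h => hsub _ h (hv.ne_of_degree_eq_one hx _).symm)
      (fun h => hsub _ h (hv.ne_of_degree_eq_one hx _).symm)

theorem IsUnicyclic.notMem_forced_of_indexDgt2_eq_empty (hG : G.IsUnicyclic) (hg : Even g)
    (hv : G.IsCycleLabelling v) (hD : G.indexDgt2 v = ∅) {x : V} (hx : G.degree x = 1) :
    x ∉ G.strongBasisForced := by
  classical
  have hD' : ∀ k y, G.degree y = 1 → y ∈ G.treeAt v k → G.degree (v (antipode k)) = 2 := by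
    intro k y hy hyk
    have h1 := hv.two_lt_degree_of_mem_treeAt hy hyk
    have h2 := hv.two_le_degree (antipode k)
    by_contra h3
    have : k ∈ G.indexDgt2 v := by
      rw [indexDgt2, Finset.mem_filter]
      exact ⟨Finset.mem_univ _, h1, by omega⟩
    simp [hD] at this
  obtain ⟨j, hxj⟩ := hG.1.exists_mem_treeAt v x
  have hj := hD' j x hx hxj
  obtain ⟨S, hS⟩ := exists_isStrongMetricBasis G
  intro hforced
  have hxS := hforced S hS
  have hcov := (hG.isStrongResolvingSet_iff hg hv).1 hS.1
  have hxv := fun k => hv.ne_of_degree_eq_one hx k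
  revert hforced
  by_cases hy : ∃ y, G.degree y = 1 ∧ y ∉ S
  · obtain ⟨y, hy1, hyS⟩ := hy
    obtain ⟨k, hyk⟩ := hG.1.exists_mem_treeAt v y
    have hk := hD' k y hy1 hyk
    have hkS := (hcov.leaf_cycle y k hy1 hyk hk).resolve_left hyS
    have hkS' : v (antipode k) ∈ S.erase x := Finset.mem_erase.2 ⟨(hxv _).symm, hkS⟩
    -- Trade `x` and the partner of the missing leaf `y` for `y` and the partner of `x`. Now only
    -- the leaf `x` can be missing, so the partner of `y` is not needed for leaves.
    refine hS.notMem_forced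
      (T := insert (v (antipode j)) (insert y ((S.erase x).erase (v (antipode k))))) ?_ ?_ ?_
    · rw [hG.isStrongResolvingSet_iff hg hv]
      have hleaf : ∀ a, G.degree a = 1 → a ≠ x →
          a ∈ insert (v (antipode j)) (insert y ((S.erase x).erase (v (antipode k)))) := by
        intro a ha hax
        have h1 := hcov.leaf_leaf a y ha hy1
        have h2 := hv.ne_of_degree_eq_one ha (antipode k)
        grind
      refine ⟨fun a b ha hb hab => ?_, fun a l ha hal hl => ?_, fun l hl hl' => ?_⟩
      · by_cases h : a = x
        · exact Or.inr (hleaf b hb (h ▸ hab.symm))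
        · exact Or.inl (hleaf a ha h)
      · by_cases h : a = x
        · subst h
          rw [hG.treeAt_eq_of_mem hv hal hxj]
          simp
        · exact Or.inl (hleaf a ha h)
      · have h1 := hv.two_lt_degree_of_mem_treeAt hy1 hyk
        -- The partner of `y` is in no degree-two antipodal pair, because the branch at `v k`
        -- contains `y`.
        have h2 : v l ≠ v (antipode k) := fun h => by
          rw [hv.injective h, antipode_antipode hg] at hl'
          omega
        have h3 : v (antipode l) ≠ v (antipode k) := fun h => by
          have := congrArg antipode (hv.injective h)
          rw [antipode_antipode hg, antipode_antipode hg] at this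
          rw [this] at hl
          omega
        have h4 := hcov.cycle_cycle l hl hl'
        have h5 := hxv l
        have h6 := hxv (antipode l)
        grind
    · have := Finset.card_insert_le (v (antipode j))
        (insert y ((S.erase x).erase (v (antipode k))))
      have := Finset.card_insert_le y ((S.erase x).erase (v (antipode k)))
      have := Finset.card_erase_add_one hxS
      have := Finset.card_erase_add_one hkS'
      omega
    · have := hxv (antipode j)
      grind
  · push Not at hy
    refine hS.notMem_forced (T := insert (v (antipode j)) (S.erase x)) ?_ ?_ ?_
    · rw [hG.isStrongResolvingSet_iff hg hv]
      refine ⟨fun a b ha hb hab => ?_, fun a l ha hal hl => ?_, fun l hl hl' => ?_⟩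
      · have h1 := hy a ha
        have h2 := hy b hb
        grind
      · by_cases h : a = x
        · subst h
          rw [hG.treeAt_eq_of_mem hv hal hxj]
          simp
        · have := hy a ha
          grind
      · have h4 := hcov.cycle_cycle l hl hl'
        have h5 := hxv l
        have h6 := hxv (antipode l)
        grind
    · have := Finset.card_insert_le (v (antipode j)) (S.erase x)
      have := Finset.card_erase_add_one hxS
      omega
    · have := hxv (antipode j)
      grind

/-- A basis missing `x` contains the partner of `x` and a leaf `y` that has no partner. Trading both
for `x` alone gives a smaller cover. -/
theorem IsUnicyclic.mem_forced (hG : G.IsUnicyclic) (hg : Even g)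
    (hv : G.IsCycleLabelling v) (hD : (G.indexDgt2 v).Nonempty) {x : V} {j : ZMod g}
    (hx : G.degree x = 1) (hxj : x ∈ G.treeAt v j) (hj : G.degree (v (antipode j)) = 2) :
    x ∈ G.strongBasisForced := by
  classical
  intro S hS
  by_contra hxS
  have hcov := (hG.isStrongResolvingSet_iff hg hv).1 hS.1
  obtain ⟨m, hm⟩ := hD
  rw [indexDgt2, Finset.mem_filter] at hm
  obtain ⟨y, hy, hym⟩ := hG.exists_leaf_mem_treeAt hv hm.2.1
  have hjS := (hcov.leaf_cycle x j hx hxj hj).resolve_left hxS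
  have hyx : y ≠ x := by
    rintro rfl
    rw [hG.treeAt_eq_of_mem hv hxj hym] at hj
    omega
  have hyS := (hcov.leaf_leaf x y hx hy hyx.symm).resolve_left hxS
  have hyS' : y ∈ S.erase (v (antipode j)) :=
    Finset.mem_erase.2 ⟨hv.ne_of_degree_eq_one hy _, hyS⟩
  have hT := hS.2 (insert x ((S.erase (v (antipode j))).erase y)) ?_
  · have := Finset.card_insert_le x ((S.erase (v (antipode j))).erase y)
    have := Finset.card_erase_add_one hjS
    have := Finset.card_erase_add_one hyS'
    omega
  · rw [hG.isStrongResolvingSet_iff hg hv]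
    have hleaf : ∀ a, G.degree a = 1 → a ≠ y →
        a ∈ insert x ((S.erase (v (antipode j))).erase y) := by
      intro a ha hay
      have h1 := hcov.leaf_leaf a x ha hx
      have h2 := hv.ne_of_degree_eq_one ha (antipode j)
      grind
    refine ⟨fun a b ha hb hab => ?_, fun a l ha hal hl => ?_, fun l hl hl' => ?_⟩
    · by_cases h : a = y
      · exact Or.inr (hleaf b hb (h ▸ hab.symm))
      · exact Or.inl (hleaf a ha h)
    · refine Or.inl (hleaf a ha ?_)
      rintro rfl
      rw [hG.treeAt_eq_of_mem hv hal hym] at hl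
      omega
    · have h1 := hv.two_lt_degree_of_mem_treeAt hx hxj
      have h2 : v l ≠ v (antipode j) := fun h => by
        rw [hv.injective h, antipode_antipode hg] at hl'
        omega
      have h3 : v (antipode l) ≠ v (antipode j) := fun h => by
        have := congrArg antipode (hv.injective h)
        rw [antipode_antipode hg, antipode_antipode hg] at this
        rw [this] at hl
        omega
      have h4 := hcov.cycle_cycle l hl hl'
      have h5 := hv.ne_of_degree_eq_one hy l
      have h6 := hv.ne_of_degree_eq_one hy (antipode l)
      grind

end Bases

/-! ### The sets of antipodal leaves -/

theorem IsCycleLabelling.mem_iUnion_antipodalLeaves_iff [NeZero g] (hg : Even g)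
    (hv : G.IsCycleLabelling v) {x : V} :
    x ∈ ⋃ i ∈ (G.indexD2 v ∪ G.indexDgt2 v)ᶜ, G.antipodalLeaves v i ↔
      ∃ j, G.degree x = 1 ∧ x ∈ G.treeAt v j ∧ G.degree (v (antipode j)) = 2 := by
  simp only [Set.mem_iUnion, exists_prop, Finset.mem_compl, Finset.mem_union, indexD2, indexDgt2,
    Finset.mem_filter, Finset.mem_univ, true_and, antipodalLeaves, Set.mem_ofPred_eq]
  constructor
  · rintro ⟨i, hi, hx, hxi⟩
    refine ⟨antipode i, hx, hxi, ?_⟩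
    rw [antipode_antipode hg]
    have h1 := hv.two_lt_degree_of_mem_treeAt hx hxi
    have h2 := hv.two_le_degree i
    omega
  · rintro ⟨j, hx, hxj, hj⟩
    have h1 := hv.two_lt_degree_of_mem_treeAt hx hxj
    refine ⟨antipode j, ?_, hx, ?_⟩
    · rw [antipode_antipode hg]
      omega
    · rwa [antipode_antipode hg]

theorem IsUnicyclic.pairwise_disjoint_antipodalLeaves [NeZero g] (hG : G.IsUnicyclic)
    (hg : Even g) (hv : G.IsCycleLabelling v) (s : Set (ZMod g)) :
    s.PairwiseDisjoint (G.antipodalLeaves v) := by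
  intro i _ j _ hij
  refine Set.disjoint_left.2 fun x hi hj => hij ?_
  have := congrArg antipode (hG.treeAt_eq_of_mem hv hi.2 hj.2)
  rwa [antipode_antipode hg, antipode_antipode hg] at this

/-- On a path from the leaf `x` to the root of its branch, the neighbour of `x` is either the root
or has a second neighbour. In the latter case it lies on the cycle, so it is again the root. -/
theorem IsUnicyclic.antipodalLeaves_eq (hG : G.IsUnicyclic) (hv : G.IsCycleLabelling v)
    (h : ∀ x, x ∉ Set.range v → G.degree x = 1) (i : ZMod g) :
    G.antipodalLeaves v i = {x | G.degree x = 1 ∧ G.Adj (v (antipode i)) x} := by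
  ext x
  refine and_congr_right fun hx => ⟨fun hxi => ?_, fun hadj => ?_⟩
  · obtain ⟨p, hp⟩ := (mem_treeAt_iff.1 hxi).symm.exists_isPath
    cases p with
    | nil => exact absurd rfl (hv.ne_of_degree_eq_one hx _)
    | @cons _ u _ hu q =>
      cases q with
      | nil => exact (deleteEdges_le _ hu).symm
      | @cons _ w _ hw r =>
        have hxu : G.Adj x u := deleteEdges_le _ hu
        have huw : G.Adj u w := deleteEdges_le _ hw
        have hne : w ≠ x := by
          rintro rfl
          simp at hp
        have hu1 : G.degree u ≠ 1 := fun h1 =>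
          hne ((degree_eq_one_iff_existsUnique_adj.1 h1).unique huw hxu.symm)
        have hur : u ∈ Set.range v := by
          by_contra hur
          exact hu1 (h u hur)
        obtain ⟨k, rfl⟩ := hur
        have : v k ∈ G.treeAt v (antipode i) := Reachable.trans hxi hu.reachable
        rw [hG.treeAt_index_unique hv this]
        exact hxu.symm
  · rcases deleteCycle_adj_or v hadj with h | ⟨k, ⟨_, h⟩ | ⟨_, h⟩⟩
    · exact h.reachable
    · exact absurd h (hv.ne_of_degree_eq_one hx _)
    · exact absurd h (hv.ne_of_degree_eq_one hx _)

end Unicyclic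

end SimpleGraph

theorem mainTheorem7 {V : Type*} [Fintype V] (G : SimpleGraph V) [DecidableRel G.Adj]
    (hG : G.IsUnicyclic) {g : ℕ} [NeZero g] (hg : Even g)
    (v : ZMod g → V) (hv : G.IsCycleLabelling v) :
    (G.indexDgt2 v = ∅ → G.strongBasisForced = ∅) ∧
    ((G.indexDgt2 v).Nonempty →
      (G.strongBasisForced = ⋃ i ∈ (G.indexD2 v ∪ G.indexDgt2 v)ᶜ, G.antipodalLeaves v i) ∧
      G.strongBasisForced.ncard =
        ∑ i ∈ (G.indexD2 v ∪ G.indexDgt2 v)ᶜ, (G.antipodalLeaves v i).ncard) ∧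
    ((∀ x, x ∉ Set.range v → G.degree x = 1) →
      ∀ i, G.antipodalLeaves v i =
        {x | G.degree x = 1 ∧ G.Adj (v (SimpleGraph.antipode i)) x}) := by
  refine ⟨fun hD => ?_, fun hD => ?_, hG.antipodalLeaves_eq hv⟩
  · refine Set.eq_empty_of_forall_notMem fun x => ?_
    by_cases hx : G.degree x = 1
    · exact hG.notMem_forced_of_indexDgt2_eq_empty hg hv hD hx
    · exact hG.notMem_forced_of_degree_ne_one hg hv hx
  · have heq : G.strongBasisForced =
        ⋃ i ∈ (G.indexD2 v ∪ G.indexDgt2 v)ᶜ, G.antipodalLeaves v i := by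
      ext x
      rw [hv.mem_iUnion_antipodalLeaves_iff hg]
      constructor
      · intro hx
        have hx1 : G.degree x = 1 := by
          by_contra h
          exact hG.notMem_forced_of_degree_ne_one hg hv h hx
        obtain ⟨j, hxj⟩ := hG.1.exists_mem_treeAt v x
        refine ⟨j, hx1, hxj, ?_⟩
        by_contra hj
        have h2 := hv.two_le_degree (SimpleGraph.antipode j)
        exact hG.notMem_forced_of_two_lt_degree hg hv hx1 hxj (by omega) hx
      · rintro ⟨j, hx, hxj, hj⟩
        exact hG.mem_forced hg hv hD hx hxj hj
    refine ⟨heq, ?_⟩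
    -- Leaf sets of different branches are disjoint, so their cardinalities add.
    rw [heq, ← finsum_mem_coe_finset,
      ← Set.Finite.ncard_biUnion (Finset.finite_toSet _) (fun _ _ => Set.toFinite _)
        (hG.pairwise_disjoint_antipodalLeaves hg hv _)]
    rfl
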